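/- For $t\in(1,2)$ let $f_t(x)=t-x^2$, $a_t=\frac{-1-\sqrt{1+4t}}2$ and $I_t=[a_t,-a_t]$, and let $\mathcal L_t g(x)=\frac{g(\sqrt{t-x})+g(-\sqrt{t-x})}{2\sqrt{t-x}}$ for $x\in(a_t,t)$, $\mathcal L_tg(x)=0$ otherwise. Let $t_0\in(1,2)$ be a stochastic parameter, that is, $f_{t_0}$ has an absolutely continuous invariant probability measure $\rho\,dx$ on $I_{t_0}$ (for instance, $t_0$ may be any Misiurewicz--Thurston parameter in $(1,2)$). Fix $\epsilon_0>0$ with $t_0-\epsilon_0>1$ and $t_0+\epsilon_0<2$, and extend the family to all real parameters by $\mathcal L_s:=\mathcal L_{t_0-\epsilon_0}$ for $s<t_0-\epsilon_0$ and $\mathcal L_s:=\mathcal L_{t_0+\epsilon_0}$ for $s>t_0+\epsilon_0$. Let $\phi:\mathbb R\to\mathbb C$ be $C^1$ with compact support. For $\eta\in(0,1)$ the two-sided Marchaud derivative is $$M^\eta g(x)=\lim_{\epsilon\downarrow0}\frac{\eta}{2\Gamma(1-\eta)}\int_{|\tau|>\epsilon}\frac{g(x+\tau)-g(x)}{|\tau|^{1+\eta}}\,\mathrm{sgn}(\tau)\,d\tau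 .$$ For a family $s\mapsto g_s$ of functions on $\mathbb R$ with primitives $G_s(x)=\int_{-\infty}^xg_s(u)\,du$, the Marchaud derivative $M^\eta_s g_s|_{s=t_0}$ with respect to the parameter, in the sense of distributions of order one, is defined when $M^\eta_sG_s(x)|_{s=t_0}$ exists for almost every $x$ and is locally integrable in $x$, by $\int (M^\eta_sg_s|_{s=t_0})\,\psi\,dx:=-\int \bigl(M^\eta_sG_s(x)|_{s=t_0}\bigr)\psi'(x)\,dx$ for compactly supported $C^1$ functions $\psi$; and $\int_{I_{t_0}}\psi\,M^\eta_s(\mathcal L_s\rho)|_{s=t_0}\,dx$ means the value of $M^\eta_s(\mathbf 1_{I_{t_0}}\mathcal L_s\rho)|_{s=t_0}$ at $\psi$. Define the formal power series in $z$ $$\Psi^{\mathrm{fr}}_\phi(\eta,z)=\sum_{k\ge0}z^k\int_{I_{t_0}}(\phi\circ f_{t_0}^k)(x)\,M^\eta_s(\mathcal L_s\rho(x))|_{s=t_0}\,dx,\qquad \Psi^{\mathrm{rsp}}_\phi(\eta,z)=\sum_{k\ge0}z^k\int_{I_{t_0}}M^\eta_x(\phi\circ f_{t_0}^k)(x)\,\rho(x)\,dx,$$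 $$\Psi_\phi(z)=\sum_{k\ge0}z^k\int(\phi\circ f_{t_0}^k)'(x)\,\rho(x)\,dx .$$ Then for every $\eta\in(0,1)$ the objects entering the coefficients of these series are well defined, and, coefficient by coefficient, $$\lim_{\eta\uparrow1}\Psi^{\mathrm{fr}}_\phi(\eta,z)=\lim_{\eta\uparrow1}\Psi^{\mathrm{rsp}}_\phi(\eta,z)=\Psi_\phi(z).$$ -/

import Mathlib

open MeasureTheory Filter Topology Set

noncomputable section

/-- The quadratic family `f_t(x) = t - x²`. -/
def quadMap (t x : ℝ) : ℝ := t - x ^ 2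

/-- The left endpoint `a_t = (-1 - √(1+4t))/2`, a fixed point of `f_t`. -/
def leftEnd (t : ℝ) : ℝ := (-1 - √(1 + 4 * t)) / 2

/-- The interval `I_t = [a_t, -a_t]`. -/
def phaseInterval (t : ℝ) : Set ℝ := Icc (leftEnd t) (-leftEnd t)

/-- `ρ` is the density of an absolutely continuous `f_t`-invariant probability measure on `I_t`.
A parameter `t` is stochastic if there is such a `ρ`. -/
structure IsInvariantDensity (t : ℝ) (ρ : ℝ → ℝ) : Prop where
  integrable : Integrable ρ
  nonneg : ∀ᵐ x : ℝ, 0 ≤ ρ x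
  eq_zero_off : ∀ᵐ x : ℝ, x ∉ phaseInterval t → ρ x = 0
  integral_eq_one : ∫ x, ρ x = 1
  invariant : MeasurePreserving (quadMap t)
    (volume.withDensity fun x => ENNReal.ofReal (ρ x))
    (volume.withDensity fun x => ENNReal.ofReal (ρ x))

/-- The transfer operator `(𝓛_t g)(x) = ∑_{f_t(y) = x} g(y) / |f_t'(y)|` for `x ∈ (a_t, t)`,
and `0` for other `x`. -/
def transferOp (t : ℝ) (g : ℝ → ℝ) : ℝ → ℝ :=
  (Ioo (leftEnd t) t).indicator fun x =>
    (g (√(t - x)) + g (-√(t - x))) / (2 * √(t - x))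

/-- The parameter is frozen outside `[t₀ - ε₀, t₀ + ε₀]`: this extends the family
`s ↦ f_s` (and so `s ↦ 𝓛_s`) to all real `s`. -/
def clampParam (t₀ ε₀ s : ℝ) : ℝ := max (t₀ - ε₀) (min s (t₀ + ε₀))

section Marchaud

variable {E : Type*} [NormedAddCommGroup E] [NormedSpace ℝ E]

/-- The integrand `(g(x+τ) - g(x)) sgn(τ) / |τ|^{1+η}`. -/
def marchaudIntegrand (η : ℝ) (g : ℝ → E) (x τ : ℝ) : E :=
  (Real.sign τ / |τ| ^ (1 + η)) • (g (x + τ) - g x)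

/-- The truncated two-sided Marchaud derivative
`M^η_ε g(x) = η / (2 Γ(1-η)) ∫_{|τ|>ε} (g(x+τ) - g(x)) sgn(τ) / |τ|^{1+η} dτ`. -/
def marchaudTrunc (η ε : ℝ) (g : ℝ → E) (x : ℝ) : E :=
  (η / (2 * Real.Gamma (1 - η))) • ∫ τ in {τ : ℝ | ε < |τ|}, marchaudIntegrand η g x τ

/-- The truncated integrals converge, and have a limit as `ε ↓ 0`. -/
def MarchaudExistsAt (η : ℝ) (g : ℝ → E) (x : ℝ) : Prop :=
  (∀ ε > 0, IntegrableOn (marchaudIntegrand η g x) {τ : ℝ | ε < |τ|}) ∧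
    ∃ m : E, Tendsto (fun ε => marchaudTrunc η ε g x) (𝓝[>] 0) (𝓝 m)

/-- The two-sided Marchaud derivative `M^η g(x) = lim_{ε ↓ 0} M^η_ε g(x)`
(meaningful where `MarchaudExistsAt η g x`). -/
def marchaud (η : ℝ) (g : ℝ → E) (x : ℝ) : E :=
  limUnder (𝓝[>] 0) fun ε => marchaudTrunc η ε g x

end Marchaud

/-- For a family `g_s(x)`, the function `x ↦ M^η_s G_s(x)|_{s = t₀}`, where
`G_s(x) = ∫_{-∞}^x g_s(u) du` and the Marchaud derivative acts on the parameter `s`. -/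
def paramMarchaudPrimitive (η : ℝ) (g : ℝ → ℝ → ℝ) (t₀ x : ℝ) : ℝ :=
  marchaud η (fun s => ∫ u in Iic x, g s u) t₀

/-- The Marchaud derivative `M^η_s g_s|_{s = t₀}` is well defined in the sense of distributions
of order one: the primitives `G_s` are well defined, `lim_{ε ↓ 0} M^η_{s,ε} G_s(x)|_{s = t₀}`
exists for almost every `x`, and this limit is a locally integrable function of `x`. -/
structure ParamMarchaudDistribExists (η : ℝ) (g : ℝ → ℝ → ℝ) (t₀ : ℝ) : Prop where
  integrableOn_Iic : ∀ s x : ℝ, IntegrableOn (g s) (Iic x)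
  exists_ae : ∀ᵐ x : ℝ, MarchaudExistsAt η (fun s => ∫ u in Iic x, g s u) t₀
  locallyIntegrable : LocallyIntegrable (paramMarchaudPrimitive η g t₀)

/-- The value of the distribution of order one `M^η_s g_s|_{s = t₀}` at a compactly supported
`C¹` function `ψ`, that is `- ∫ [lim_{ε ↓ 0} M^η_{s,ε} G_s(x)|_{s = t₀}] ψ'(x) dx`. -/
def paramMarchaudPairing (η : ℝ) (g : ℝ → ℝ → ℝ) (t₀ : ℝ) (ψ : ℝ → ℂ) : ℂ :=
  -∫ x, paramMarchaudPrimitive η g t₀ x • deriv ψ x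

/-- The family `s ↦ 𝟙_{I_{t₀}} 𝓛_s ρ`. The indicator, which does not depend on `s`, accounts for
the integration over `I_{t₀}` in the frozen susceptibility function. -/
def frozenFamily (t₀ ε₀ : ℝ) (ρ : ℝ → ℝ) (s : ℝ) : ℝ → ℝ :=
  (phaseInterval t₀).indicator (transferOp (clampParam t₀ ε₀ s) ρ)

/-- The frozen fractional susceptibility function
`∑_k z^k ∫_{I_{t₀}} (φ ∘ f_{t₀}^k)(x) M^η_s(𝓛_s ρ(x))|_{s = t₀} dx`, with the Marchaud derivative
taken in the sense of distributions of order one. -/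
def frozenSusceptibility (t₀ ε₀ : ℝ) (ρ : ℝ → ℝ) (φ : ℝ → ℂ) (η : ℝ) : PowerSeries ℂ :=
  PowerSeries.mk fun k =>
    paramMarchaudPairing η (frozenFamily t₀ ε₀ ρ) t₀ (φ ∘ (quadMap t₀)^[k])

/-- The response fractional susceptibility function
`∑_k z^k ∫_{I_{t₀}} M^η_x(φ ∘ f_{t₀}^k)(x) ρ(x) dx`. -/
def responseSusceptibility (t₀ : ℝ) (ρ : ℝ → ℝ) (φ : ℝ → ℂ) (η : ℝ) : PowerSeries ℂ :=
  PowerSeries.mk fun k =>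
    ∫ x in phaseInterval t₀, ρ x • marchaud η (φ ∘ (quadMap t₀)^[k]) x

/-- Ruelle's susceptibility function `∑_k z^k ∫ (φ ∘ f_{t₀}^k)'(x) ρ(x) dx`. -/
def ruelleSusceptibility (t₀ : ℝ) (ρ : ℝ → ℝ) (φ : ℝ → ℂ) : PowerSeries ℂ :=
  PowerSeries.mk fun k => ∫ x, ρ x • deriv (φ ∘ (quadMap t₀)^[k]) x

/-- Convergence of formal power series: every coefficient converges. -/
def FormalTendsto {ι : Type*} (F : ι → PowerSeries ℂ) (l : Filter ι) (G : PowerSeries ℂ) : Prop :=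
  ∀ k : ℕ, Tendsto (fun i => PowerSeries.coeff k (F i)) l (𝓝 (PowerSeries.coeff k G))

end

/-! As the order tends to 1, the normalised odd kernel turns into differentiation at the origin: its
constant tends to 0, so every fixed region away from the origin loses its weight, while its pairing
with the truncated identity is exactly `1/Γ(2-η)`, which tends to 1. Hence an increment `K` bounded
by `C min(|τ|,1)` and differentiable at 0 has regularised integral tending to `K'(0)`
(`tendsto_marchaudConst_integral`).

For the response series, `K` is the increment of the compactly supported `C¹` function `φ ∘ f^k`.
The bounds are uniform in `x`, and dominated convergence against `ρ` concludes.

For the frozen series, `f_s` is `f_t` followed by translation by `s - t`. By duality and invariance,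
`𝓛_s ρ` is therefore `ρ` translated by `s - t`, apart from the cut-off at `-a_t`
(`integral_Iic_frozenFamily`). This requires that no mass be lost at the left ends, which holds
because the invariant measure lives on the core `[t - t², t)` (`ae_mem_core`). The distribution
function `R` of `ρ` need not be Hölder, but it is monotone and bounded, so its translates vary
linearly in `L¹`. Fubini then gives existence of the parameter derivative for almost every `x`, and
lets it be paired with `ψ'` before integrating in `τ`. Near `τ = 0` the paired increment is `∫ ρ(v)
(ψ(v+τ) - ψ(v)) dv`, with derivative `∫ ρ ψ'`, the same limit as on the response side. -/

/-! ### The kernel and its normalising constant -/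

/-- The function `τ ↦ min(|τ|^p, 1) / |τ|^{1+η}` is integrable at the origin and at infinity. -/
theorem integrableOn_Ioi_inv_rpow_mul_min {η p : ℝ} (hη : 0 < η) (hp : η < p) :
    IntegrableOn (fun τ : ℝ => (τ ^ (1 + η))⁻¹ * min (τ ^ p) 1) (Ioi 0) ∧
      ∫ τ in Ioi (0 : ℝ), (τ ^ (1 + η))⁻¹ * min (τ ^ p) 1 = 1 / (p - η) + 1 / η := by
  have hp0 : 0 < p := hη.trans hp
  have e1 : EqOn (fun τ : ℝ => τ ^ (p - 1 - η)) (fun τ : ℝ => (τ ^ (1 + η))⁻¹ * min (τ ^ p) 1)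
      (Ioc 0 1) := by
    intro τ hτ
    have h1 : τ ^ p ≤ 1 := Real.rpow_le_one hτ.1.le hτ.2 hp0.le
    simp only [min_eq_left h1]
    rw [← Real.rpow_neg hτ.1.le, ← Real.rpow_add hτ.1]
    ring_nf
  have e2 : EqOn (fun τ : ℝ => τ ^ (-(1 + η))) (fun τ : ℝ => (τ ^ (1 + η))⁻¹ * min (τ ^ p) 1)
      (Ioi 1) := by
    intro τ hτ
    have h1 : 1 ≤ τ ^ p := Real.one_le_rpow (le_of_lt hτ) hp0.le
    simp only [min_eq_right h1, mul_one]
    rw [← Real.rpow_neg (zero_le_one.trans (le_of_lt hτ))]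
  have i1 : IntegrableOn (fun τ : ℝ => (τ ^ (1 + η))⁻¹ * min (τ ^ p) 1) (Ioc 0 1) := by
    refine IntegrableOn.congr_fun ?_ e1 measurableSet_Ioc
    exact (intervalIntegrable_iff_integrableOn_Ioc_of_le zero_le_one).1
      (intervalIntegral.intervalIntegrable_rpow' (by linarith))
  have i2 : IntegrableOn (fun τ : ℝ => (τ ^ (1 + η))⁻¹ * min (τ ^ p) 1) (Ioi 1) := by
    refine IntegrableOn.congr_fun ?_ e2 measurableSet_Ioi
    exact integrableOn_Ioi_rpow_of_lt (by linarith) one_pos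
  rw [← Ioc_union_Ioi_eq_Ioi (zero_le_one (α := ℝ))]
  refine ⟨i1.union i2, ?_⟩
  rw [setIntegral_union Ioc_disjoint_Ioi_same measurableSet_Ioi i1 i2,
    ← setIntegral_congr_fun measurableSet_Ioc e1, ← setIntegral_congr_fun measurableSet_Ioi e2,
    integral_Ioi_rpow_of_lt (by linarith) one_pos, ← intervalIntegral.integral_of_le zero_le_one,
    integral_rpow (Or.inl (by linarith)), Real.one_rpow, Real.one_rpow, Real.zero_rpow (by linarith)]
  congr 1
  · rw [sub_zero]; ring_nf
  · rw [div_eq_div_iff (by linarith) hη.ne']; ring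

theorem integral_inv_rpow_mul_min {η p : ℝ} (hη : 0 < η) (hp : η < p) :
    ∫ τ : ℝ, (|τ| ^ (1 + η))⁻¹ * min (|τ| ^ p) 1 = 2 * (1 / (p - η) + 1 / η) := by
  rw [integral_comp_abs (f := fun τ : ℝ => (τ ^ (1 + η))⁻¹ * min (τ ^ p) 1),
    (integrableOn_Ioi_inv_rpow_mul_min hη hp).2]

theorem integrable_inv_rpow_mul_min {η p : ℝ} (hη : 0 < η) (hp : η < p) :
    Integrable (fun τ : ℝ => (|τ| ^ (1 + η))⁻¹ * min (|τ| ^ p) 1) := by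
  -- A non-integrable function has integral 0 by convention, so the positive value just computed
  -- forces integrability.
  refine Integrable.of_integral_ne_zero ?_
  rw [integral_inv_rpow_mul_min hη hp]
  have := sub_pos.2 hp
  positivity

/-- The odd kernel `sgn(τ) / |τ|^{1+η}`. -/
noncomputable def oddKernel (η τ : ℝ) : ℝ := Real.sign τ / |τ| ^ (1 + η)

/-- The normalising constant `η / (2 Γ(1-η))`. -/
noncomputable def marchaudConst (η : ℝ) : ℝ := η / (2 * Real.Gamma (1 - η))

theorem abs_oddKernel_le (η τ : ℝ) : |oddKernel η τ| ≤ (|τ| ^ (1 + η))⁻¹ := by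
  rw [oddKernel, abs_div, abs_of_nonneg (Real.rpow_nonneg (abs_nonneg τ) _), div_eq_mul_inv]
  refine mul_le_of_le_one_left (by positivity) ?_
  rcases Real.sign_apply_eq τ with h | h | h <;> rw [h] <;> norm_num

theorem measurable_oddKernel (η : ℝ) : Measurable (oddKernel η) := by
  have h : Measurable Real.sign := by
    unfold Real.sign
    exact Measurable.ite measurableSet_Iio measurable_const
      (Measurable.ite measurableSet_Ioi measurable_const measurable_const)
  unfold oddKernel
  fun_prop

theorem marchaudConst_nonneg {η : ℝ} (hη : 0 < η) (hη1 : η < 1) : 0 ≤ marchaudConst η :=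
  div_nonneg hη.le (mul_nonneg zero_le_two (Real.Gamma_pos_of_pos (by linarith)).le)

/-- The bracket equals `1/(η(1-η))`, and `(1-η) Γ(1-η) = Γ(2-η)` absorbs the pole at `η = 1`. -/
theorem marchaudConst_mul {η : ℝ} (hη : 0 < η) (hη1 : η < 1) :
    marchaudConst η * (2 * (1 / (1 - η) + 1 / η)) = (Real.Gamma (2 - η))⁻¹ := by
  have h := Real.Gamma_add_one (s := 1 - η) (by linarith)
  have h1 : 0 < Real.Gamma (1 - η) := Real.Gamma_pos_of_pos (by linarith)
  have h2 : (1 - η) ≠ 0 := by linarith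
  rw [show 2 - η = 1 - η + 1 by ring, h, marchaudConst]
  field_simp
  ring

theorem tendsto_inv_Gamma_two_sub :
    Tendsto (fun η : ℝ => (Real.Gamma (2 - η))⁻¹) (𝓝[<] 1) (𝓝 1) := by
  have h : ContinuousAt (fun η : ℝ => (Real.Gamma (2 - η))⁻¹) 1 := by
    refine ContinuousAt.inv₀ ?_ ?_
    · refine ContinuousAt.comp (g := Real.Gamma) ?_ (by fun_prop)
      refine (Real.differentiableAt_Gamma fun m => ?_).continuousAt
      have : (0 : ℝ) ≤ m := m.cast_nonneg
      linarith
    · norm_num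
  have h' := h.tendsto
  norm_num at h'
  exact h'.mono_left nhdsWithin_le_nhds

theorem eventually_mem_Ioo_half :
    ∀ᶠ η : ℝ in 𝓝[<] 1, η ∈ Ioo (1 / 2 : ℝ) 1 :=
  Ioo_mem_nhdsLT (by norm_num)

theorem tendsto_marchaudConst : Tendsto marchaudConst (𝓝[<] 1) (𝓝 0) := by
  have h0 : Tendsto (fun η : ℝ => η * (1 - η) / 2) (𝓝[<] 1) (𝓝 0) := by
    have : Continuous fun η : ℝ => η * (1 - η) / 2 := by fun_prop
    have h := this.tendsto 1
    norm_num at h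
    exact h.mono_left nhdsWithin_le_nhds
  have h := h0.mul tendsto_inv_Gamma_two_sub
  rw [zero_mul] at h
  refine h.congr' ?_
  filter_upwards [eventually_mem_Ioo_half] with η hη
  have hη0 : 0 < η := by linarith [hη.1]
  have h2 : (1 - η) ≠ 0 := by linarith [hη.2]
  rw [← marchaudConst_mul hη0 hη.2]
  field_simp
  ring

/-! ### Regularised integrals as the order tends to 1 -/

section
variable {E : Type*} [NormedAddCommGroup E] [NormedSpace ℝ E]

theorem integrable_oddKernel_smul {η p C : ℝ} (hη : 0 < η) (hp : η < p) {K : ℝ → E}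
    (hm : AEStronglyMeasurable K) (hK : ∀ τ, ‖K τ‖ ≤ C * min (|τ| ^ p) 1) :
    Integrable fun τ => oddKernel η τ • K τ := by
  refine ((integrable_inv_rpow_mul_min hη hp).const_mul C).mono'
    ((measurable_oddKernel η).aestronglyMeasurable.smul hm) (ae_of_all _ fun τ => ?_)
  rw [norm_smul, Real.norm_eq_abs]
  calc |oddKernel η τ| * ‖K τ‖ ≤ (|τ| ^ (1 + η))⁻¹ * (C * min (|τ| ^ p) 1) :=
        mul_le_mul (abs_oddKernel_le η τ) (hK τ) (norm_nonneg _) (by positivity)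
    _ = _ := by ring

theorem norm_integral_oddKernel_smul_le {η p C : ℝ} (hη : 0 < η) (hp : η < p) {K : ℝ → E}
    (hK : ∀ τ, ‖K τ‖ ≤ C * min (|τ| ^ p) 1) :
    ‖∫ τ, oddKernel η τ • K τ‖ ≤ C * (2 * (1 / (p - η) + 1 / η)) := by
  rw [← integral_inv_rpow_mul_min hη hp, ← integral_const_mul]
  refine norm_integral_le_of_norm_le ((integrable_inv_rpow_mul_min hη hp).const_mul C)
    (ae_of_all _ fun τ => ?_)
  rw [norm_smul, Real.norm_eq_abs]
  calc |oddKernel η τ| * ‖K τ‖ ≤ (|τ| ^ (1 + η))⁻¹ * (C * min (|τ| ^ p) 1) :=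
        mul_le_mul (abs_oddKernel_le η τ) (hK τ) (norm_nonneg _) (by positivity)
    _ = _ := by ring

theorem norm_marchaudConst_smul_integral_le {η C : ℝ} (hη : 0 < η) (hη1 : η < 1) {K : ℝ → E}
    (hK : ∀ τ, ‖K τ‖ ≤ C * min |τ| 1) :
    ‖marchaudConst η • ∫ τ, oddKernel η τ • K τ‖ ≤ C * (Real.Gamma (2 - η))⁻¹ := by
  have h := norm_integral_oddKernel_smul_le (K := K) (C := C) hη hη1 (by simpa using hK)
  rw [norm_smul, Real.norm_of_nonneg (marchaudConst_nonneg hη hη1), ← marchaudConst_mul hη hη1]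
  calc _ ≤ marchaudConst η * (C * (2 * (1 / (1 - η) + 1 / η))) :=
        mul_le_mul_of_nonneg_left h (marchaudConst_nonneg hη hη1)
    _ = _ := by ring

/-- The regularised integral of a function vanishing to first order at `0` tends to `0`. -/
theorem tendsto_marchaudConst_integral_zero {C : ℝ} {K : ℝ → E}
    (hK : ∀ τ, ‖K τ‖ ≤ C * min |τ| 1) (hd : HasDerivAt K 0 0) :
    Tendsto (fun η => marchaudConst η • ∫ τ, oddKernel η τ • K τ) (𝓝[<] 1) (𝓝 0) := by
  have hC : 0 ≤ C := by simpa using (norm_nonneg _).trans (hK 1)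
  have hK0 : K 0 = 0 := by simpa using hK 0
  rw [Metric.tendsto_nhds]
  intro ε hε
  obtain ⟨δ, hδ, hδK⟩ : ∃ δ > 0, ∀ τ, |τ| < δ → ‖K τ‖ ≤ ε / 4 * |τ| := by
    have h := hd.isLittleO
    simp only [hK0, sub_zero, smul_zero] at h
    have h := h.def (c := ε / 4) (by positivity)
    obtain ⟨δ, hδ, h⟩ := Metric.eventually_nhds_iff.1 h
    exact ⟨δ, hδ, fun τ hτ => h (by simpa using hτ)⟩
  set δ' := min δ 1 with hδ'
  have hδ'0 : 0 < δ' := lt_min hδ one_pos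
  -- The second term controls `|τ| ≥ δ'`. Its kernel integral, with exponent 2, stays bounded as `η
  -- ↑ 1`, so the vanishing constant kills it; the first term contributes at most `ε/4 · 1/Γ(2-η)`,
  -- which is eventually below `ε/2`.
  have hb : ∀ τ, ‖K τ‖ ≤ ε / 4 * min |τ| 1 + C / δ' ^ 2 * min (|τ| ^ (2 : ℝ)) 1 := by
    intro τ
    rw [Real.rpow_two]
    rcases lt_or_ge |τ| δ' with h | h
    · have h1 : |τ| < 1 := h.trans_le (min_le_right _ _)
      rw [min_eq_left h1.le]
      have := hδK τ (h.trans_le (min_le_left _ _))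
      have : 0 ≤ C / δ' ^ 2 * min (|τ| ^ 2) 1 := by positivity
      linarith
    · have h1 : ‖K τ‖ ≤ C := (hK τ).trans (mul_le_of_le_one_right hC (min_le_right _ _))
      have h2 : δ' ^ 2 ≤ min (|τ| ^ 2) 1 := le_min (by gcongr)
        (pow_le_one₀ hδ'0.le (min_le_right _ _))
      have h3 : C ≤ C / δ' ^ 2 * min (|τ| ^ 2) 1 := by
        calc C = C / δ' ^ 2 * δ' ^ 2 := by field_simp
          _ ≤ _ := by gcongr
      have : 0 ≤ ε / 4 * min |τ| 1 := by positivity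
      linarith
  have hsmall : Tendsto (fun η => marchaudConst η * (C / δ' ^ 2 * (2 * (1 + 2)))) (𝓝[<] 1)
      (𝓝 0) := by
    simpa using tendsto_marchaudConst.mul_const (C / δ' ^ 2 * (2 * (1 + 2)))
  filter_upwards [eventually_mem_Ioo_half, hsmall.eventually (gt_mem_nhds (half_pos hε)),
    tendsto_inv_Gamma_two_sub.eventually (gt_mem_nhds (show (1 : ℝ) < 2 by norm_num))]
    with η hη h1 h2
  have hη0 : 0 < η := by linarith [hη.1]
  rw [dist_zero_right, norm_smul, Real.norm_of_nonneg (marchaudConst_nonneg hη0 hη.2)]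
  have i1 := integrable_inv_rpow_mul_min (p := 1) hη0 hη.2
  have i2 := integrable_inv_rpow_mul_min (p := 2) hη0 (by linarith [hη.2])
  have hle : ‖∫ τ, oddKernel η τ • K τ‖ ≤
      ε / 4 * (2 * (1 / (1 - η) + 1 / η)) + C / δ' ^ 2 * (2 * (1 / (2 - η) + 1 / η)) := by
    rw [← integral_inv_rpow_mul_min hη0 hη.2,
      ← integral_inv_rpow_mul_min hη0 (show η < 2 by linarith [hη.2]), ← integral_const_mul,
      ← integral_const_mul, ← integral_add (i1.const_mul _) (i2.const_mul _)]
    refine norm_integral_le_of_norm_le ((i1.const_mul _).add (i2.const_mul _))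
      (ae_of_all _ fun τ => ?_)
    rw [norm_smul, Real.norm_eq_abs]
    refine (mul_le_mul (abs_oddKernel_le η τ) (hb τ) (norm_nonneg _) (by positivity)).trans_eq ?_
    simp only [Real.rpow_one]
    ring
  have h3 : 1 / (2 - η) + 1 / η ≤ 1 + 2 := by
    refine add_le_add ?_ ?_
    · rw [div_le_one (by linarith [hη.2])]; linarith [hη.2]
    · rw [div_le_iff₀ hη0]; linarith [hη.1]
  calc marchaudConst η * ‖∫ τ, oddKernel η τ • K τ‖
      ≤ marchaudConst η * (ε / 4 * (2 * (1 / (1 - η) + 1 / η))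
          + C / δ' ^ 2 * (2 * (1 + 2))) := by
        refine mul_le_mul_of_nonneg_left (hle.trans ?_) (marchaudConst_nonneg hη0 hη.2)
        gcongr
    _ = ε / 4 * (Real.Gamma (2 - η))⁻¹ + marchaudConst η * (C / δ' ^ 2 * (2 * (1 + 2))) := by
        rw [← marchaudConst_mul hη0 hη.2]; ring
    _ < ε := by nlinarith

/-- The regularised integral of `K` tends to `K'(0)` as the order tends to `1`. -/
theorem tendsto_marchaudConst_integral [CompleteSpace E] {C : ℝ} {K : ℝ → E} {D : E}
    (hm : AEStronglyMeasurable K) (hK : ∀ τ, ‖K τ‖ ≤ C * min |τ| 1) (hd : HasDerivAt K D 0) :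
    Tendsto (fun η => marchaudConst η • ∫ τ, oddKernel η τ • K τ) (𝓝[<] 1) (𝓝 D) := by
  -- The truncated identity has derivative 1 at 0 and an explicit kernel integral. Subtracting `T •
  -- D` reduces the claim to an increment with zero derivative.
  let T : ℝ → ℝ := fun τ => Real.sign τ * min |τ| 1
  have hTc : T = fun τ => max (-1) (min τ 1) := by
    funext τ
    rcases lt_trichotomy τ 0 with h | h | h
    · simp only [T, Real.sign_of_neg h, abs_of_neg h]
      rw [min_eq_left (h.le.trans zero_le_one), neg_one_mul, ← max_neg_neg, neg_neg, max_comm]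
    · simp [T, h]
    · simp only [T, Real.sign_of_pos h, abs_of_pos h, one_mul]
      rw [max_eq_right]
      exact le_min (by linarith) (by norm_num)
  have hTcont : Continuous T := by rw [hTc]; fun_prop
  have hTb : ∀ τ, |T τ| ≤ 1 * min |τ| 1 := by
    intro τ
    rw [abs_mul, abs_of_nonneg (le_min (abs_nonneg τ) zero_le_one)]
    gcongr
    rcases Real.sign_apply_eq τ with h | h | h <;> rw [h] <;> norm_num
  have hTd : HasDerivAt T 1 0 := by
    refine (hasDerivAt_id (0 : ℝ)).congr_of_eventuallyEq ?_
    filter_upwards [Ioo_mem_nhds (show (-1 : ℝ) < 0 by norm_num) one_pos] with τ hτ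
    rw [hTc]
    simp [min_eq_left hτ.2.le, max_eq_right hτ.1.le]
  have hJd : HasDerivAt (fun τ => K τ - T τ • D) 0 0 := by
    have h := hd.sub (hTd.smul_const D)
    rwa [one_smul, sub_self] at h
  have hTDb : ∀ τ, ‖T τ • D‖ ≤ ‖D‖ * min |τ| 1 := fun τ => by
    rw [norm_smul, Real.norm_eq_abs, mul_comm]
    simpa using mul_le_mul_of_nonneg_left (hTb τ) (norm_nonneg D)
  have hTDm : AEStronglyMeasurable fun τ => T τ • D :=
    (hTcont.smul continuous_const).aestronglyMeasurable
  have hJ := tendsto_marchaudConst_integral_zero (C := C + ‖D‖) (K := fun τ => K τ - T τ • D)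
    (fun τ => by
      rw [add_mul]
      exact (norm_sub_le _ _).trans (add_le_add (hK τ) (hTDb τ))) hJd
  have h := hJ.add (tendsto_inv_Gamma_two_sub.smul_const D)
  rw [one_smul, zero_add] at h
  refine h.congr' ?_
  filter_upwards [eventually_mem_Ioo_half] with η hη
  have hη0 : 0 < η := by linarith [hη.1]
  have iK := integrable_oddKernel_smul (p := 1) hη0 hη.2 hm (by simpa using hK)
  have iT := integrable_oddKernel_smul (p := 1) hη0 hη.2 hTDm (by simpa using hTDb)
  have hTi : ∫ τ, oddKernel η τ • T τ • D = (2 * (1 / (1 - η) + 1 / η)) • D := by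
    rw [← integral_inv_rpow_mul_min hη0 hη.2, ← integral_smul_const]
    refine integral_congr_ae (ae_of_all _ fun τ => ?_)
    simp only [smul_smul, Real.rpow_one]
    congr 1
    simp only [oddKernel, T]
    rcases lt_trichotomy τ 0 with h | h | h
    · rw [Real.sign_of_neg h]; ring
    · simp [h]
    · rw [Real.sign_of_pos h]; ring
  simp only [smul_sub]
  rw [integral_sub iK iT, smul_sub, hTi, smul_smul, marchaudConst_mul hη0 hη.2, sub_add_cancel]

/-- The full integrand is absolutely integrable, so the truncations converge by dominated
convergence without any cancellation near 0. -/
theorem tendsto_marchaudTrunc {η x : ℝ} {g : ℝ → E} (h : Integrable (marchaudIntegrand η g x)) :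
    Tendsto (fun ε => marchaudTrunc η ε g x) (𝓝[>] 0)
      (𝓝 (marchaudConst η • ∫ τ, oddKernel η τ • (g (x + τ) - g x))) := by
  refine Tendsto.const_smul ?_ _
  have hms : ∀ ε : ℝ, MeasurableSet {τ : ℝ | ε < |τ|} := fun ε =>
    measurableSet_lt measurable_const measurable_id.abs
  simp_rw [← integral_indicator (hms _)]
  refine tendsto_integral_filter_of_dominated_convergence (fun τ => ‖marchaudIntegrand η g x τ‖)
    ?_ ?_ h.norm ?_
  · exact Eventually.of_forall fun ε => (h.indicator (hms ε)).aestronglyMeasurable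
  · exact Eventually.of_forall fun ε => ae_of_all _ fun τ => norm_indicator_le_norm_self _ _
  · have h0 : ∀ᵐ τ : ℝ, τ ≠ 0 := by simp [ae_iff]
    filter_upwards [h0] with τ hτ
    refine tendsto_const_nhds.congr' ?_
    filter_upwards [Ioo_mem_nhdsGT (abs_pos.2 hτ)] with ε hε
    rw [indicator_of_mem (show τ ∈ {τ : ℝ | ε < |τ|} from hε.2)]
    rfl

theorem marchaudExistsAt_of_integrable {η x : ℝ} {g : ℝ → E}
    (h : Integrable (marchaudIntegrand η g x)) : MarchaudExistsAt η g x :=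
  ⟨fun _ _ => h.integrableOn, _, tendsto_marchaudTrunc h⟩

theorem marchaud_eq_of_integrable {η x : ℝ} {g : ℝ → E}
    (h : Integrable (marchaudIntegrand η g x)) :
    marchaud η g x = marchaudConst η • ∫ τ, oddKernel η τ • (g (x + τ) - g x) :=
  (tendsto_marchaudTrunc h).limUnder_eq

end

/-! ### The observable along the orbit, and the response side -/

theorem hasCompactSupport_comp_quadMap {E : Type*} [Zero E] {g : ℝ → E} (hg : HasCompactSupport g)
    (t : ℝ) : HasCompactSupport (g ∘ quadMap t) := by
  obtain ⟨M, hM⟩ := hg.isCompact.isBounded.exists_norm_le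
  refine HasCompactSupport.intro (K := Icc (-(1 + |t| + |M|)) (1 + |t| + |M|)) isCompact_Icc
    fun x hx => ?_
  by_contra h
  have h1 := hM _ (subset_tsupport _ (Function.mem_support.2 h))
  rw [Real.norm_eq_abs, abs_le, quadMap] at h1
  refine hx (abs_le.1 ?_)
  have : x ^ 2 ≤ |t| + |M| := by linarith [le_abs_self t, le_abs_self M]
  have := abs_nonneg t
  have := abs_nonneg M
  refine abs_le_of_sq_le_sq ?_ (by positivity)
  nlinarith

theorem contDiff_comp_iterate_quadMap {φ : ℝ → ℂ} (hφ : ContDiff ℝ 1 φ) (t : ℝ) (k : ℕ) :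
    ContDiff ℝ 1 (φ ∘ (quadMap t)^[k]) := by
  have hq : ContDiff ℝ 1 (quadMap t) := by
    unfold quadMap
    fun_prop
  induction k with
  | zero => exact hφ
  | succ k ih =>
    rw [Function.iterate_succ, ← Function.comp_assoc]
    exact ih.comp hq

theorem hasCompactSupport_comp_iterate_quadMap {E : Type*} [Zero E] {φ : ℝ → E}
    (hφ : HasCompactSupport φ) (t : ℝ) (k : ℕ) : HasCompactSupport (φ ∘ (quadMap t)^[k]) := by
  induction k with
  | zero => exact hφ
  | succ k ih =>
    rw [Function.iterate_succ, ← Function.comp_assoc]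
    exact hasCompactSupport_comp_quadMap ih t

/-- A compactly supported `C¹` function is bounded and Lipschitz. -/
theorem exists_bound_increment {ψ : ℝ → ℂ} (hψ : ContDiff ℝ 1 ψ) (hc : HasCompactSupport ψ) :
    ∃ C, (∀ x, ‖ψ x‖ ≤ C) ∧ (∀ x, ‖deriv ψ x‖ ≤ C) ∧
      ∀ x τ, ‖ψ (x + τ) - ψ x‖ ≤ C * min |τ| 1 := by
  obtain ⟨A, hA⟩ := hψ.continuous.bounded_above_of_compact_support hc
  obtain ⟨B, hB⟩ := (hψ.continuous_deriv le_rfl).bounded_above_of_compact_support hc.deriv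
  have hA0 := (norm_nonneg _).trans (hA 0)
  have hB0 := (norm_nonneg _).trans (hB 0)
  refine ⟨2 * A + B, fun x => (hA x).trans (by linarith), fun x => (hB x).trans (by linarith),
    fun x τ => ?_⟩
  rcases le_total |τ| 1 with h | h
  · rw [min_eq_left h]
    have := Convex.norm_image_sub_le_of_norm_deriv_le (𝕜 := ℝ) (f := ψ) (s := univ)
      (x := x) (y := x + τ)
      (fun y _ => hψ.differentiable one_ne_zero y) (fun y _ => hB y) convex_univ trivial trivial
    rw [add_sub_cancel_left, Real.norm_eq_abs] at this
    exact this.trans (mul_le_mul_of_nonneg_right (by linarith) (abs_nonneg τ))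
  · rw [min_eq_right h]
    have := norm_sub_le (ψ (x + τ)) (ψ x)
    linarith [hA x, hA (x + τ)]

section
variable {ψ : ℝ → ℂ} (hψ : ContDiff ℝ 1 ψ) (hc : HasCompactSupport ψ)
include hψ

theorem hasDerivAt_increment (x : ℝ) :
    HasDerivAt (fun τ => ψ (x + τ) - ψ x) (deriv ψ x) 0 := by
  have h : HasDerivAt ψ (deriv ψ x) (x + 0) := by
    rw [add_zero]
    exact (hψ.differentiable one_ne_zero x).hasDerivAt
  exact (h.comp_const_add x 0).sub_const _

include hc

theorem integrable_marchaudIntegrand {η : ℝ} (hη : η ∈ Ioo (0 : ℝ) 1) (x : ℝ) :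
    Integrable (marchaudIntegrand η ψ x) := by
  obtain ⟨C, -, -, hC⟩ := exists_bound_increment hψ hc
  have := hψ.continuous
  exact integrable_oddKernel_smul (p := 1) hη.1 hη.2
    (Continuous.aestronglyMeasurable (by fun_prop)) (by simpa using hC x)

theorem stronglyMeasurable_marchaud {η : ℝ} (hη : η ∈ Ioo (0 : ℝ) 1) :
    StronglyMeasurable (marchaud η ψ) := by
  have h : marchaud η ψ =
      fun x => marchaudConst η • ∫ τ, oddKernel η τ • (ψ (x + τ) - ψ x) := by
    funext x
    exact marchaud_eq_of_integrable (integrable_marchaudIntegrand hψ hc hη x)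
  rw [h]
  have := hψ.continuous
  have hm : StronglyMeasurable fun p : ℝ × ℝ => oddKernel η p.2 • (ψ (p.1 + p.2) - ψ p.1) :=
    ((measurable_oddKernel η).comp measurable_snd).stronglyMeasurable.smul
      (Continuous.stronglyMeasurable (by fun_prop))
  exact hm.integral_prod_right'.const_smul (marchaudConst η)

/-- A bound uniform in `x` whose dependence on `η` stays bounded as `η ↑ 1`; it supplies the
dominating function against `ρ`. -/
theorem exists_norm_marchaud_le : ∃ C, ∀ η ∈ Ioo (0 : ℝ) 1, ∀ x,
    ‖marchaud η ψ x‖ ≤ C * (Real.Gamma (2 - η))⁻¹ := by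
  obtain ⟨C, -, -, hC⟩ := exists_bound_increment hψ hc
  refine ⟨C, fun η hη x => ?_⟩
  rw [marchaud_eq_of_integrable (integrable_marchaudIntegrand hψ hc hη x)]
  exact norm_marchaudConst_smul_integral_le hη.1 hη.2 (hC x)

/-- The Marchaud derivative tends pointwise to the derivative as its order tends to `1`. -/
theorem tendsto_marchaud_deriv (x : ℝ) :
    Tendsto (fun η => marchaud η ψ x) (𝓝[<] 1) (𝓝 (deriv ψ x)) := by
  obtain ⟨C, -, -, hC⟩ := exists_bound_increment hψ hc
  have := hψ.continuous
  refine (tendsto_marchaudConst_integral (Continuous.aestronglyMeasurable (by fun_prop)) (hC x)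
    (hasDerivAt_increment hψ x)).congr' ?_
  filter_upwards [eventually_mem_Ioo_half] with η hη
  exact (marchaud_eq_of_integrable (integrable_marchaudIntegrand hψ hc
    ⟨by linarith [hη.1], hη.2⟩ x)).symm

theorem integrable_smul_marchaud {ρ : ℝ → ℝ} (hρ : Integrable ρ) {η : ℝ}
    (hη : η ∈ Ioo (0 : ℝ) 1) : Integrable fun x => ρ x • marchaud η ψ x := by
  obtain ⟨C, hC⟩ := exists_norm_marchaud_le hψ hc
  exact hρ.smul_bdd _ (stronglyMeasurable_marchaud hψ hc hη).aestronglyMeasurable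
    (ae_of_all _ (hC η hη))

theorem integrable_smul_deriv {ρ : ℝ → ℝ} (hρ : Integrable ρ) :
    Integrable fun x => ρ x • deriv ψ x := by
  obtain ⟨C, -, hC, -⟩ := exists_bound_increment hψ hc
  exact hρ.smul_bdd _ (hψ.continuous_deriv le_rfl).aestronglyMeasurable (ae_of_all _ hC)

theorem tendsto_integral_smul_marchaud {ρ : ℝ → ℝ} (hρ : Integrable ρ) :
    Tendsto (fun η => ∫ x, ρ x • marchaud η ψ x) (𝓝[<] 1) (𝓝 (∫ x, ρ x • deriv ψ x)) := by
  obtain ⟨C, hC⟩ := exists_norm_marchaud_le hψ hc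
  have hmem : ∀ᶠ η : ℝ in 𝓝[<] 1, η ∈ Ioo (0 : ℝ) 1 := Ioo_mem_nhdsLT one_pos
  refine tendsto_integral_filter_of_dominated_convergence (fun x => ‖ρ x‖ * (|C| * 2)) ?_ ?_
    (hρ.norm.mul_const _) (ae_of_all _ fun x => (tendsto_marchaud_deriv hψ hc x).const_smul _)
  · filter_upwards [hmem] with η hη
    exact (integrable_smul_marchaud hψ hc hρ hη).aestronglyMeasurable
  · filter_upwards [hmem, tendsto_inv_Gamma_two_sub.eventually
      (gt_mem_nhds (show (1 : ℝ) < 2 by norm_num))] with η hη h2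
    refine ae_of_all _ fun x => ?_
    rw [norm_smul]
    have hΓ : 0 ≤ (Real.Gamma (2 - η))⁻¹ :=
      inv_nonneg.2 (Real.Gamma_pos_of_pos (by linarith [hη.2])).le
    refine mul_le_mul_of_nonneg_left ((hC η hη x).trans ?_) (norm_nonneg _)
    exact mul_le_mul (le_abs_self C) h2.le hΓ (abs_nonneg C)

end

/-! ### Dynamics and support of the invariant measure -/

theorem quadMap_leftEnd {t : ℝ} (ht : 0 < t) : quadMap t (leftEnd t) = leftEnd t := by
  have h : √(1 + 4 * t) ^ 2 = 1 + 4 * t := Real.sq_sqrt (by linarith)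
  unfold quadMap leftEnd
  nlinarith

/-- The hypothesis is `(2t-1)² < 1+4s`. It keeps `s - t²`, the left end of the core of `f_t` shifted
by `s - t`, inside both intervals. -/
theorem leftEnd_lt_neg {s t : ℝ} (h : t ^ 2 - t < s) : leftEnd s < -t := by
  have : 2 * t - 1 < √(1 + 4 * s) := Real.lt_sqrt_of_sq_lt (by nlinarith)
  unfold leftEnd
  linarith

theorem leftEnd_lt {s t : ℝ} (h : t ^ 2 - t < s) : leftEnd s < s - t ^ 2 :=
  (leftEnd_lt_neg h).trans (by linarith)

/-- `f_t(x) - x` is a concave quadratic that vanishes at `a_t` and is positive at 0. Thus orbits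
left of the core drift to the right. -/
theorem quadMap_gt {t x : ℝ} (ht : 0 < t) (hx : leftEnd t < x) (hx0 : x < 0) :
    x < quadMap t x := by
  have h2 := quadMap_leftEnd ht
  have h1 : 1 ≤ √(1 + 4 * t) := Real.one_le_sqrt.2 (by linarith)
  have h3 : leftEnd t ≤ -1 := by unfold leftEnd; linarith
  unfold quadMap at *
  nlinarith

theorem measurable_quadMap (t : ℝ) : Measurable (quadMap t) := by
  unfold quadMap
  fun_prop

/-- The measure with density `ρ`. -/
noncomputable def densityMeasure (ρ : ℝ → ℝ) : Measure ℝ :=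
  volume.withDensity fun x => ENNReal.ofReal (ρ x)

/-- The distribution function of the measure with density `ρ`. -/
noncomputable def distribFun (ρ : ℝ → ℝ) (x : ℝ) : ℝ := ∫ v in Iic x, ρ v

namespace IsInvariantDensity

variable {t : ℝ} {ρ : ℝ → ℝ} (h : IsInvariantDensity t ρ)
include h

theorem densityMeasure_eq {A : Set ℝ} (hA : MeasurableSet A) :
    densityMeasure ρ A = ENNReal.ofReal (∫ x in A, ρ x) := by
  rw [densityMeasure, withDensity_apply _ hA,
    ofReal_integral_eq_lintegral_ofReal h.integrable.integrableOn (ae_restrict_of_ae h.nonneg)]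

theorem setIntegral_eq_real {A : Set ℝ} (hA : MeasurableSet A) :
    ∫ x in A, ρ x = (densityMeasure ρ).real A := by
  rw [Measure.real, h.densityMeasure_eq hA,
    ENNReal.toReal_ofReal (setIntegral_nonneg_of_ae h.nonneg)]

theorem isProbabilityMeasure : IsProbabilityMeasure (densityMeasure ρ) :=
  ⟨by rw [h.densityMeasure_eq MeasurableSet.univ, setIntegral_univ, h.integral_eq_one,
    ENNReal.ofReal_one]⟩

theorem ae_densityMeasure_iff {p : ℝ → Prop} :
    (∀ᵐ x ∂densityMeasure ρ, p x) ↔ ∀ᵐ x, ρ x ≠ 0 → p x := by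
  rw [densityMeasure, ae_withDensity_iff' h.integrable.aemeasurable.ennreal_ofReal]
  refine eventually_congr ?_
  filter_upwards [h.nonneg] with x hx
  rw [Ne, ENNReal.ofReal_eq_zero, not_le, lt_iff_le_and_ne, and_iff_right hx, ne_comm]

theorem ae_ne (a : ℝ) : ∀ᵐ x ∂densityMeasure ρ, x ≠ a := by
  rw [h.ae_densityMeasure_iff]
  have : ∀ᵐ x : ℝ, x ≠ a := by simp [ae_iff]
  filter_upwards [this] with x hx _ using hx

theorem ae_mem_phaseInterval : ∀ᵐ x ∂densityMeasure ρ, x ∈ phaseInterval t := by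
  rw [h.ae_densityMeasure_iff]
  filter_upwards [h.eq_zero_off] with x hx hx0
  by_contra hn
  exact hx0 (hx hn)

theorem measurePreserving :
    MeasurePreserving (quadMap t) (densityMeasure ρ) (densityMeasure ρ) := h.invariant

theorem ae_of_ae_comp {S : Set ℝ} (hS : MeasurableSet S)
    (hf : ∀ᵐ x ∂densityMeasure ρ, quadMap t x ∈ S) : ∀ᵐ x ∂densityMeasure ρ, x ∈ S := by
  rw [← h.measurePreserving.map_eq]
  exact (ae_map_iff (measurable_quadMap t).aemeasurable hS).2 hf

/-- The invariant measure lives on the core `[f_t(t), t]` of the dynamics. -/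
theorem ae_mem_core (ht : 1 < t) (ht2 : t < 2) :
    ∀ᵐ x ∂densityMeasure ρ, x ∈ Ico (t - t ^ 2) t := by
  have := h.isProbabilityMeasure
  have hlt : ∀ᵐ x ∂densityMeasure ρ, x < t := by
    refine h.ae_of_ae_comp measurableSet_Iio ?_
    filter_upwards [h.ae_ne 0] with x hx
    have : 0 < x ^ 2 := by positivity
    exact sub_lt_self t this
  set c := t - t ^ 2 with hcdef
  have htc : -t < c := by nlinarith
  -- A bounded Lyapunov function: `F ∘ f_t - F` is nonnegative almost everywhere and has zero
  -- integral by invariance, so it vanishes almost everywhere. It is strictly positive on `(a_t,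
  -- -t)`, which therefore carries no mass.
  let F : ℝ → ℝ := fun x => max (leftEnd t) (min x c)
  have hFc : Continuous F := by fun_prop
  have hFb : ∀ x, ‖F x‖ ≤ |leftEnd t| + |c| := fun x => by
    rw [Real.norm_eq_abs, abs_le]
    constructor
    · have := le_max_left (leftEnd t) (min x c)
      linarith [neg_abs_le (leftEnd t), abs_nonneg c]
    · refine max_le ?_ ((min_le_right _ _).trans ?_)
      · linarith [le_abs_self (leftEnd t), abs_nonneg c]
      · linarith [le_abs_self c, abs_nonneg (leftEnd t)]
  have hFi : Integrable F (densityMeasure ρ) :=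
    Integrable.of_bound hFc.aestronglyMeasurable _ (ae_of_all _ hFb)
  have hFfi : Integrable (fun x => F (quadMap t x)) (densityMeasure ρ) :=
    Integrable.of_bound (hFc.measurable.comp (measurable_quadMap t)).aestronglyMeasurable _
      (ae_of_all _ fun x => hFb _)
  have hint : ∫ x, F (quadMap t x) ∂densityMeasure ρ = ∫ x, F x ∂densityMeasure ρ := by
    conv_rhs => rw [← h.measurePreserving.map_eq]
    rw [integral_map (measurable_quadMap t).aemeasurable hFc.aestronglyMeasurable]
  have hgood : ∀ᵐ x ∂densityMeasure ρ, leftEnd t < x ∧ x < t := by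
    filter_upwards [h.ae_mem_phaseInterval, hlt, h.ae_ne (leftEnd t)] with x hx h1 h2
    exact ⟨lt_of_le_of_ne hx.1 h2.symm, h1⟩
  have hkey : ∀ x, leftEnd t < x → x < t → F x ≤ F (quadMap t x) ∧
      (x < -t → F x < F (quadMap t x)) := by
    intro x hx1 hx2
    rcases lt_or_ge x (-t) with hxt | hxt
    · have hq := quadMap_gt (by linarith) hx1 (by linarith)
      have : F x < F (quadMap t x) := by
        simp only [F]
        rw [min_eq_left (by linarith : x ≤ c), max_eq_right hx1.le]
        exact lt_max_of_lt_right (lt_min hq (by linarith))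
      exact ⟨this.le, fun _ => this⟩
    · refine ⟨?_, fun h' => absurd h' (not_lt.2 hxt)⟩
      have hq : c ≤ quadMap t x := by
        simp only [quadMap, hcdef]
        nlinarith
      simp only [F]
      rw [min_eq_right hq]
      exact max_le_max le_rfl (min_le_right _ _)
  have hae : (fun x => F (quadMap t x) - F x) =ᵐ[densityMeasure ρ] 0 := by
    refine (integral_eq_zero_iff_of_nonneg_ae ?_ (hFfi.sub hFi)).1 ?_
    · filter_upwards [hgood] with x hx
      exact sub_nonneg.2 (hkey x hx.1 hx.2).1
    · simp only [Pi.sub_def]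
      rw [integral_sub hFfi hFi, hint, sub_self]
  have hge : ∀ᵐ x ∂densityMeasure ρ, c ≤ x := by
    -- Almost every point lies in `[-t, t)`, and `f_t` maps that interval into `[t - t², ∞)`;
    -- invariance transfers this bound to the measure itself.
    refine h.ae_of_ae_comp (S := Ici c) measurableSet_Ici ?_
    filter_upwards [hae, hgood] with x h1 h2
    have hxt : -t ≤ x := by
      by_contra hn
      have := (hkey x h2.1 h2.2).2 (not_le.1 hn)
      have h1' : F (quadMap t x) - F x = 0 := h1
      linarith
    simp only [quadMap, hcdef, mem_Ici]
    nlinarith [h2.2]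
  filter_upwards [hge, hlt] with x h1 h2 using ⟨h1, h2⟩

theorem distribFun_eq_real (x : ℝ) : distribFun ρ x = (densityMeasure ρ).real (Iic x) :=
  h.setIntegral_eq_real measurableSet_Iic

theorem monotone_distribFun : Monotone (distribFun ρ) := by
  have := h.isProbabilityMeasure
  intro x y hxy
  rw [h.distribFun_eq_real, h.distribFun_eq_real]
  exact measureReal_mono (Iic_subset_Iic.2 hxy)

theorem distribFun_nonneg (x : ℝ) : 0 ≤ distribFun ρ x := by
  rw [h.distribFun_eq_real]
  exact measureReal_nonneg

theorem distribFun_le_one (x : ℝ) : distribFun ρ x ≤ 1 := by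
  have := h.isProbabilityMeasure
  rw [h.distribFun_eq_real]
  exact measureReal_le_one

theorem distribFun_eq_one (ht : 1 < t) (ht2 : t < 2) {x : ℝ} (hx : t ≤ x) :
    distribFun ρ x = 1 := by
  have := h.isProbabilityMeasure
  rw [h.distribFun_eq_real, ← probReal_univ (μ := densityMeasure ρ)]
  refine measureReal_congr ?_
  filter_upwards [h.ae_mem_core ht ht2] with v hv
  exact propext ⟨fun _ => trivial, fun _ => (hv.2.le.trans hx : v ≤ x)⟩

end IsInvariantDensity

theorem continuous_distribFun {ρ : ℝ → ℝ} (h : Integrable ρ) : Continuous (distribFun ρ) := by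
  have : distribFun ρ = fun x => distribFun ρ 0 + ∫ v in (0 : ℝ)..x, ρ v := by
    funext x
    rw [← intervalIntegral.integral_Iic_sub_Iic h.integrableOn h.integrableOn, distribFun,
      distribFun]
    ring
  rw [this]
  exact continuous_const.add (intervalIntegral.continuous_primitive
    (fun a b => h.intervalIntegrable) 0)

/-! ### Duality and the translated measure -/

/-- The transfer operator is dual to the composition by `f_s`. -/
theorem integrableOn_transfer_and_integral_eq {s : ℝ} {ρ : ℝ → ℝ} (hρ : Integrable ρ) {B : Set ℝ}
    (hB : MeasurableSet B) (hBs : B ⊆ Iio s) :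
    IntegrableOn (fun x => (ρ (√(s - x)) + ρ (-√(s - x))) / (2 * √(s - x))) B ∧
      ∫ x in B, (ρ (√(s - x)) + ρ (-√(s - x))) / (2 * √(s - x)) =
        ∫ y in quadMap s ⁻¹' B, ρ y := by
  have hpre : MeasurableSet (quadMap s ⁻¹' B) := measurable_quadMap s hB
  have hd : ∀ A : Set ℝ, ∀ y ∈ A, HasDerivWithinAt (quadMap s) (-(2 * y)) A y := by
    intro A y _
    have h1 : HasDerivAt (fun y : ℝ => s - y ^ 2) (-(2 * y)) y := by
      simpa using (hasDerivAt_pow 2 y).const_sub s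
    exact h1.hasDerivWithinAt
  -- Change of variables on one inverse branch `y = e √(s - x)`; `e = 1` and `e = -1` give the two
  -- branches, which miss only the null set `{0}`.
  have main : ∀ e : ℝ, e ^ 2 = 1 →
      IntegrableOn (fun x => ρ (e * √(s - x)) / (2 * √(s - x))) B ∧
      ∫ x in B, ρ (e * √(s - x)) / (2 * √(s - x)) =
        ∫ y in quadMap s ⁻¹' B ∩ {y | 0 < e * y}, ρ y := by
    intro e he
    set A := quadMap s ⁻¹' B ∩ {y | 0 < e * y} with hAdef
    have hA : MeasurableSet A := hpre.inter (measurableSet_lt measurable_const (by fun_prop))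
    have hsq : ∀ y ∈ A, √(s - quadMap s y) = e * y := by
      intro y hy
      rw [quadMap, show s - (s - y ^ 2) = (e * y) ^ 2 by rw [mul_pow, he]; ring,
        Real.sqrt_sq (le_of_lt hy.2)]
    have hinj : InjOn (quadMap s) A := by
      intro y hy z hz hyz
      have h1 : e * y = e * z := by rw [← hsq y hy, ← hsq z hz, hyz]
      have h2 : e ≠ 0 := by rintro rfl; norm_num at he
      exact mul_left_cancel₀ h2 h1
    have himg : quadMap s '' A = B := by
      ext x
      constructor
      · rintro ⟨y, hy, rfl⟩
        exact hy.1
      · intro hx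
        have hxs : 0 < s - x := sub_pos.2 (hBs hx)
        have hq : quadMap s (e * √(s - x)) = x := by
          rw [quadMap, mul_pow, he, Real.sq_sqrt hxs.le]
          ring
        refine ⟨e * √(s - x), ⟨by rwa [mem_preimage, hq], ?_⟩, hq⟩
        simp only [mem_ofPred_eq, ← mul_assoc, ← sq, he, one_mul]
        exact Real.sqrt_pos.2 hxs
    have hcongr : EqOn (fun y => |-(2 * y)| • (ρ (e * √(s - quadMap s y)) /
        (2 * √(s - quadMap s y)))) ρ A := by
      intro y hy
      have hy2 : 0 < e * y := hy.2
      have habs : |y| = e * y := by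
        have : |e| = 1 := by rwa [← sq_eq_sq₀ (abs_nonneg e) zero_le_one, sq_abs, one_pow]
        rw [← abs_of_pos hy2, abs_mul, this, one_mul]
      simp only [hsq y hy, smul_eq_mul]
      rw [show e * (e * y) = e ^ 2 * y by ring, he, one_mul, abs_neg, abs_mul, habs, abs_two]
      generalize e * y = z at hy2
      field_simp
    constructor
    · rw [← himg, integrableOn_image_iff_integrableOn_abs_deriv_smul hA (hd A) hinj]
      exact hρ.integrableOn.congr_fun hcongr.symm hA
    · conv_lhs => rw [← himg]
      rw [integral_image_eq_integral_abs_deriv_smul hA (hd A) hinj]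
      exact setIntegral_congr_fun hA hcongr
  obtain ⟨i1, e1⟩ := main 1 (by norm_num)
  obtain ⟨i2, e2⟩ := main (-1) (by norm_num)
  simp only [one_mul, neg_one_mul, neg_pos] at i1 e1 i2 e2
  simp only [add_div]
  refine ⟨i1.add i2, ?_⟩
  rw [integral_add i1 i2, e1, e2, ← setIntegral_union (t := quadMap s ⁻¹' B ∩ {y | y < 0}) ?_
    (hpre.inter measurableSet_Iio) hρ.integrableOn hρ.integrableOn]
  · refine setIntegral_congr_set ?_
    have h0 : ∀ᵐ y : ℝ, y ≠ 0 := by simp [ae_iff]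
    filter_upwards [h0] with y hy
    refine propext ⟨fun h => h.elim And.left And.left, fun h => ?_⟩
    exact (lt_or_gt_of_ne hy).elim (fun h' => Or.inr ⟨h, h'⟩) fun h' => Or.inl ⟨h, h'⟩
  · rw [disjoint_left]
    rintro y ⟨_, hy⟩ ⟨_, hy'⟩
    exact lt_asymm (a := (0 : ℝ)) (b := y) hy hy'

namespace IsInvariantDensity

variable {t : ℝ} {ρ : ℝ → ℝ} (h : IsInvariantDensity t ρ)
include h

theorem integrableOn_frozenFamily (ε₀ s x : ℝ) :
    IntegrableOn (frozenFamily t ε₀ ρ s) (Iic x) := by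
  refine Integrable.integrableOn ?_
  refine Integrable.indicator ?_ measurableSet_Icc
  exact (integrable_indicator_iff measurableSet_Ioo).2
    (integrableOn_transfer_and_integral_eq h.integrable measurableSet_Ioo fun _ hx => hx.2).1

/-- Up to the cut-off at `-a_t`, the measure transported by `𝓛_s` is a translate of the
invariant measure. -/
theorem integral_Iic_frozenFamily (ht : 1 < t) {ε₀ : ℝ} (hε₀ : 0 ≤ ε₀) (hε₂ : t + ε₀ < 2)
    (s x : ℝ) :
    ∫ u in Iic x, frozenFamily t ε₀ ρ s u =
      distribFun ρ (min x (-leftEnd t) - (clampParam t ε₀ s - t)) := by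
  have ht2 : t < 2 := by linarith
  have hs1 : t - ε₀ ≤ clampParam t ε₀ s := le_max_left _ _
  -- From `ε₀ < 2 - t < t(2 - t)` one gets `t² - t < t - ε₀`.
  have hs : t ^ 2 - t < clampParam t ε₀ s := by nlinarith
  generalize hs' : clampParam t ε₀ s = s' at *
  have hend1 : leftEnd s' < s' - t ^ 2 := leftEnd_lt hs
  have hend2 : leftEnd t < -t := leftEnd_lt_neg (by nlinarith)
  have hmeas : MeasurableSet (Iic x ∩ phaseInterval t ∩ Ioo (leftEnd s') s') :=
    (measurableSet_Iic.inter measurableSet_Icc).inter measurableSet_Ioo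
  rw [frozenFamily, hs', setIntegral_indicator (t := phaseInterval t) measurableSet_Icc, transferOp,
    setIntegral_indicator measurableSet_Ioo,
    (integrableOn_transfer_and_integral_eq h.integrable hmeas fun _ hx => hx.2.2).2]
  -- Here the parameter becomes a translation: `f_{s'} = f_t + (s' - t)`, so invariance under `f_t`
  -- can be applied to the shifted set.
  have hpre : quadMap s' ⁻¹' (Iic x ∩ phaseInterval t ∩ Ioo (leftEnd s') s') =
      quadMap t ⁻¹' ((fun v => v + (s' - t)) ⁻¹'
        (Iic x ∩ phaseInterval t ∩ Ioo (leftEnd s') s')) := by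
    rw [← preimage_comp]
    congr 1
    funext v
    simp only [quadMap, Function.comp]
    ring
  have hmeas' : MeasurableSet ((fun v => v + (s' - t)) ⁻¹'
      (Iic x ∩ phaseInterval t ∩ Ioo (leftEnd s') s')) := measurable_add_const _ hmeas
  rw [hpre, h.setIntegral_eq_real (measurable_quadMap t hmeas'), h.distribFun_eq_real,
    h.measurePreserving.measureReal_preimage hmeas'.nullMeasurableSet]
  refine measureReal_congr ?_
  filter_upwards [h.ae_mem_core ht ht2] with v hv
  refine propext ⟨fun hv' => ?_, fun hv' => ?_⟩
  · have h1 : v + (s' - t) ≤ x := hv'.1.1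
    have h2 : v + (s' - t) ≤ -leftEnd t := hv'.1.2.2
    exact le_sub_iff_add_le.2 (le_min h1 h2)
  · have h1 := le_min_iff.1 (le_sub_iff_add_le.1 (show v ≤ _ from hv'))
    refine ⟨⟨h1.1, ?_, h1.2⟩, ?_, ?_⟩
    · have := hv.1
      simp only
      linarith
    · have := hv.1
      simp only
      linarith
    · have := hv.2
      simp only
      linarith

end IsInvariantDensity

/-! ### Translates of the distribution function -/

/-- The `L¹` modulus of continuity of a monotone function with values in `[0, 1]`. -/
theorem intervalIntegral_abs_translate_sub_le {R : ℝ → ℝ} (hR : Monotone R) (h0 : ∀ x, 0 ≤ R x)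
    (h1 : ∀ x, R x ≤ 1) {c d : ℝ} (hcd : c ≤ d) (σ : ℝ) :
    ∫ x in c..d, |R (x - σ) - R x| ≤ 2 * |σ| := by
  have hi : ∀ a b : ℝ, IntervalIntegrable R volume a b := fun a b => hR.intervalIntegrable
  have hRs : Monotone fun x => R (x - σ) := fun x y hxy => hR (by linarith)
  -- The difference reduces to integrals over two windows of length `|σ|` at the ends, where `0 ≤ R
  -- ≤ 1`.
  have hsub : |∫ x in c..d, (R (x - σ) - R x)| ≤ 2 * |σ| := by
    rw [intervalIntegral.integral_sub hRs.intervalIntegrable (hi _ _),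
      intervalIntegral.integral_comp_sub_right,
      intervalIntegral.integral_interval_sub_interval_comm (hi _ _) (hi _ _) (hi _ _)]
    have hb : ∀ a b : ℝ, |∫ x in a..b, R x| ≤ 1 * |b - a| := fun a b =>
      intervalIntegral.norm_integral_le_of_norm_le_const fun x _ => by
        rw [Real.norm_of_nonneg (h0 x)]
        exact h1 x
    refine (abs_sub _ _).trans ?_
    have e1 := hb (c - σ) c
    have e2 := hb (d - σ) d
    rw [sub_sub_cancel] at e1 e2
    linarith
  -- By monotonicity the increment has constant sign, so the absolute value moves outside the
  -- integral.
  refine le_trans (le_of_eq ?_) hsub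
  rcases le_total 0 σ with hσ | hσ
  · have hneg : ∀ x, |R (x - σ) - R x| = -(R (x - σ) - R x) := fun x =>
      abs_of_nonpos (sub_nonpos.2 (hR (by linarith)))
    simp only [hneg]
    rw [intervalIntegral.integral_neg, abs_of_nonpos]
    rw [← neg_nonneg, ← intervalIntegral.integral_neg]
    exact intervalIntegral.integral_nonneg hcd fun x _ => hneg x ▸ abs_nonneg _
  · have hpos : ∀ x, |R (x - σ) - R x| = R (x - σ) - R x := fun x =>
      abs_of_nonneg (sub_nonneg.2 (hR (by linarith)))
    simp only [hpos]
    rw [abs_of_nonneg]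
    exact intervalIntegral.integral_nonneg hcd fun x _ => hpos x ▸ abs_nonneg _

/-- The increment `G_{t+τ}(x) - G_t(x)` of the primitives of a family of translates, cut off at
`b` and frozen for `|τ| ≥ ε`. -/
noncomputable def frozenIncrement (R : ℝ → ℝ) (b ε x τ : ℝ) : ℝ :=
  R (min x b - max (-ε) (min τ ε)) - R (min x b)

theorem abs_max_min_le {ε : ℝ} (hε : 0 ≤ ε) (τ : ℝ) : |max (-ε) (min τ ε)| ≤ |τ| := by
  rw [abs_le]
  constructor
  · rcases le_total τ ε with h | h
    · rw [min_eq_left h]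
      exact (neg_abs_le τ).trans (le_max_right _ _)
    · have := abs_nonneg τ
      have : 0 ≤ max (-ε) (min τ ε) := le_max_of_le_right (le_min (hε.trans h) hε)
      linarith
  · exact max_le (by linarith [abs_nonneg τ]) ((min_le_left _ _).trans (le_abs_self τ))

theorem clampParam_sub {t ε : ℝ} (τ : ℝ) : clampParam t ε (t + τ) - t = max (-ε) (min τ ε) := by
  rw [clampParam, min_add_add_left, sub_eq_add_neg t ε, max_add_add_left, add_sub_cancel_left]

theorem Continuous.frozenIncrement {R : ℝ → ℝ} (hR : Continuous R) (b ε : ℝ) :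
    Continuous fun p : ℝ × ℝ => frozenIncrement R b ε p.1 p.2 := by
  unfold _root_.frozenIncrement
  fun_prop

/-- `∫ R(x - σ) ψ'(x) dx = - ∫ ψ(v + σ) dR(v)`. -/
theorem integral_distribFun_smul_deriv {ρ : ℝ → ℝ} (hρ : Integrable ρ) {ψ : ℝ → ℂ}
    (hψ : ContDiff ℝ 1 ψ) (hc : HasCompactSupport ψ) (σ : ℝ) :
    ∫ x, distribFun ρ (x - σ) • deriv ψ x = -∫ v, ρ v • ψ (v + σ) := by
  have hψ' : Integrable (deriv ψ) :=
    (hψ.continuous_deriv le_rfl).integrable_of_hasCompactSupport hc.deriv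
  let S : Set (ℝ × ℝ) := {p | p.2 + σ ≤ p.1}
  have hS : MeasurableSet S := measurableSet_le (by fun_prop) (by fun_prop)
  have hint : Integrable (S.indicator fun p : ℝ × ℝ => ρ p.2 • deriv ψ p.1)
      (volume.prod volume) := by
    refine Integrable.indicator ?_ hS
    exact (hρ.smul_prod hψ').swap
  have hl : ∀ x, distribFun ρ (x - σ) • deriv ψ x =
      ∫ v, S.indicator (fun p : ℝ × ℝ => ρ p.2 • deriv ψ p.1) (x, v) := by
    intro x
    rw [distribFun, ← integral_smul_const, ← integral_indicator measurableSet_Iic]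
    refine integral_congr_ae (ae_of_all _ fun v => ?_)
    simp only [indicator, S, mem_Iic, mem_ofPred_eq, le_sub_iff_add_le]
  have hr : ∀ v, ∫ x, S.indicator (fun p : ℝ × ℝ => ρ p.2 • deriv ψ p.1) (x, v) =
      -(ρ v • ψ (v + σ)) := by
    intro v
    rw [← smul_neg, ← hc.integral_Ioi_deriv_eq hψ, ← integral_Ici_eq_integral_Ioi,
      ← integral_smul, ← integral_indicator measurableSet_Ici]
    rfl
  simp only [hl]
  rw [integral_integral_swap (f := fun x v =>
    S.indicator (fun p : ℝ × ℝ => ρ p.2 • deriv ψ p.1) (x, v)) hint]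
  simp only [hr]
  exact integral_neg _

/-- With the translation placed on the `C¹` function, integrability of `ρ` suffices. -/
theorem hasDerivAt_integral_smul_translate {ρ : ℝ → ℝ} (hρ : Integrable ρ) {ψ : ℝ → ℂ}
    (hψ : ContDiff ℝ 1 ψ) (hc : HasCompactSupport ψ) :
    HasDerivAt (fun σ => ∫ v, ρ v • ψ (v + σ)) (∫ v, ρ v • deriv ψ v) 0 := by
  obtain ⟨C, hC0, hC, -⟩ := exists_bound_increment hψ hc
  have hcont := hψ.continuous
  have hcont' := hψ.continuous_deriv le_rfl
  have hi : ∀ σ, Integrable fun v => ρ v • ψ (v + σ) := fun σ =>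
    hρ.smul_bdd C (Continuous.aestronglyMeasurable (by fun_prop)) (ae_of_all _ fun v => hC0 _)
  have h := (hasDerivAt_integral_of_dominated_loc_of_deriv_le (μ := volume) (x₀ := (0 : ℝ))
    (s := univ) (F := fun σ v => ρ v • ψ (v + σ)) (F' := fun σ v => ρ v • deriv ψ (v + σ))
    (bound := fun v => ‖ρ v‖ * C) univ_mem
    (Eventually.of_forall fun σ => (hi σ).aestronglyMeasurable) (hi 0) ?_ ?_
    (hρ.norm.mul_const C) ?_).2
  · simpa using h
  · exact hρ.aestronglyMeasurable.smul (Continuous.aestronglyMeasurable (by fun_prop))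
  · refine ae_of_all _ fun v σ _ => ?_
    rw [norm_smul]
    exact mul_le_mul_of_nonneg_left (hC _) (norm_nonneg _)
  · refine ae_of_all _ fun v σ _ => HasDerivAt.fun_const_smul _ ?_
    exact (hψ.differentiable one_ne_zero (v + σ)).hasDerivAt.comp_const_add v σ

/-! ### Marchaud derivative in the parameter -/

namespace IsInvariantDensity

variable {t ε₀ : ℝ} {ρ : ℝ → ℝ} (h : IsInvariantDensity t ρ) (ht : 1 < t) (hε₀ : 0 < ε₀)
  (hε₂ : t + ε₀ < 2)
include h

theorem continuous_frozenIncrement (b ε : ℝ) :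
    Continuous fun p : ℝ × ℝ => frozenIncrement (distribFun ρ) b ε p.1 p.2 :=
  (continuous_distribFun h.integrable).frozenIncrement b ε

theorem abs_distribFun_sub_le_one (x y : ℝ) : |distribFun ρ x - distribFun ρ y| ≤ 1 :=
  abs_le.2 ⟨by linarith [h.distribFun_nonneg x, h.distribFun_le_one y],
    by linarith [h.distribFun_nonneg y, h.distribFun_le_one x]⟩

include ht hε₀ hε₂

/-- Below the cut-off this is the `L¹` modulus of `R`. Beyond it the increment is constant in `x`:
it vanishes for shifts up to the gap `δ = -a_t - t`, as `R = 1` past `t`, and for larger shifts it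
is at most `1 ≤ |σ|/δ`. For `|τ| ≥ 1` the trivial bound 1 on the increment is enough. -/
theorem exists_integral_abs_frozenIncrement_le {n : ℝ} (hn : 0 ≤ n) :
    ∃ C, ∀ τ, ∫ x in Icc (-n) n, |frozenIncrement (distribFun ρ) (-leftEnd t) ε₀ x τ| ≤
      C * min |τ| 1 := by
  have ht2 : t < 2 := by linarith
  have hb : 0 < -leftEnd t - t := by
    linarith [leftEnd_lt_neg (s := t) (t := t) (by nlinarith)]
  set δ := -leftEnd t - t with hδ
  have hbt : -leftEnd t = t + δ := by rw [hδ]; ring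
  refine ⟨2 + 2 * n / δ + 2 * n, fun τ => ?_⟩
  rw [hbt]
  set σ := max (-ε₀) (min τ ε₀) with hσdef
  have hσ : |σ| ≤ |τ| := abs_max_min_le hε₀.le τ
  have hend : |distribFun ρ (t + δ - σ) - distribFun ρ (t + δ)| ≤ |σ| / δ := by
    rcases le_or_gt |σ| δ with h' | h'
    · have := le_abs_self σ
      rw [h.distribFun_eq_one ht ht2 (by linarith), h.distribFun_eq_one ht ht2 (by linarith),
        sub_self, abs_zero]
      positivity
    · exact (h.abs_distribFun_sub_le_one _ _).trans ((one_le_div hb).2 h'.le)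
  have hpt : ∀ x, |frozenIncrement (distribFun ρ) (t + δ) ε₀ x τ| ≤
      |distribFun ρ (x - σ) - distribFun ρ x| + |σ| / δ := by
    intro x
    rw [frozenIncrement]
    rcases le_total x (t + δ) with h' | h'
    · rw [min_eq_left h']
      exact le_add_of_nonneg_right (by positivity)
    · rw [min_eq_right h']
      exact hend.trans (le_add_of_nonneg_left (abs_nonneg _))
  have hcont := h.continuous_frozenIncrement (t + δ) ε₀
  have hcont1 : Continuous fun x => frozenIncrement (distribFun ρ) (t + δ) ε₀ x τ :=
    hcont.comp (by fun_prop : Continuous fun x : ℝ => (x, τ))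
  have hRc := continuous_distribFun h.integrable
  have hnn : -n ≤ n := by linarith
  rw [integral_Icc_eq_integral_Ioc, ← intervalIntegral.integral_of_le hnn]
  have hle1 : ∫ x in -n..n, |frozenIncrement (distribFun ρ) (t + δ) ε₀ x τ| ≤
      2 * |σ| + 2 * n * (|σ| / δ) := by
    calc _ ≤ ∫ x in -n..n, (|distribFun ρ (x - σ) - distribFun ρ x| + |σ| / δ) :=
          intervalIntegral.integral_mono_on hnn (hcont1.abs.intervalIntegrable _ _)
            (Continuous.intervalIntegrable (by fun_prop) _ _) fun x _ => hpt x
      _ = (∫ x in -n..n, |distribFun ρ (x - σ) - distribFun ρ x|) + 2 * n * (|σ| / δ) := by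
          rw [intervalIntegral.integral_add (Continuous.intervalIntegrable (by fun_prop) _ _)
            (Continuous.intervalIntegrable (by fun_prop) _ _), intervalIntegral.integral_const,
            smul_eq_mul]
          ring
      _ ≤ _ := by
          gcongr
          exact intervalIntegral_abs_translate_sub_le h.monotone_distribFun h.distribFun_nonneg
            h.distribFun_le_one hnn σ
  have hle2 : ∫ x in -n..n, |frozenIncrement (distribFun ρ) (t + δ) ε₀ x τ| ≤ 2 * n := by
    calc _ ≤ ∫ x in -n..n, (1 : ℝ) :=
          intervalIntegral.integral_mono_on hnn (hcont1.abs.intervalIntegrable _ _)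
            (Continuous.intervalIntegrable (by fun_prop) _ _)
            fun x _ => h.abs_distribFun_sub_le_one _ _
      _ = _ := by rw [intervalIntegral.integral_const, smul_eq_mul]; ring
  have hnd : 0 ≤ 2 * n / δ := by positivity
  rcases le_total |τ| 1 with h' | h'
  · rw [min_eq_left h']
    have e1 : (2 + 2 * n / δ) * |σ| ≤ (2 + 2 * n / δ) * |τ| := by gcongr
    have e2 : 2 * n * (|σ| / δ) = 2 * n / δ * |σ| := by ring
    have e3 : 0 ≤ 2 * n * |τ| := by positivity
    linarith
  · rw [min_eq_right h']
    linarith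

/-- Integrating in `x` first replaces the missing pointwise regularity of `R` by its linear `L¹`
modulus, which the kernel can absorb since `η < 1`. -/
theorem integrable_oddKernel_smul_frozenIncrement {η : ℝ} (hη : η ∈ Ioo (0 : ℝ) 1) {n : ℝ}
    (hn : 0 ≤ n) :
    Integrable (fun p : ℝ × ℝ =>
      oddKernel η p.2 • frozenIncrement (distribFun ρ) (-leftEnd t) ε₀ p.1 p.2)
      ((volume.restrict (Icc (-n) n)).prod volume) := by
  have hcont := h.continuous_frozenIncrement (-leftEnd t) ε₀
  have hcont1 : ∀ τ, Continuous fun x =>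
      frozenIncrement (distribFun ρ) (-leftEnd t) ε₀ x τ := fun τ =>
    hcont.comp (by fun_prop : Continuous fun x : ℝ => (x, τ))
  rw [integrable_prod_iff']
  · refine ⟨ae_of_all _ fun τ => ((hcont1 τ).integrableOn_Icc).smul (oddKernel η τ), ?_⟩
    obtain ⟨C, hC⟩ := h.exists_integral_abs_frozenIncrement_le ht hε₀ hε₂ hn
    have hN0 : ∀ τ, 0 ≤
        ∫ x in Icc (-n) n, |frozenIncrement (distribFun ρ) (-leftEnd t) ε₀ x τ| := fun τ =>
      integral_nonneg fun x => abs_nonneg _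
    have hm : StronglyMeasurable fun τ =>
        ∫ x in Icc (-n) n, |frozenIncrement (distribFun ρ) (-leftEnd t) ε₀ x τ| :=
      hcont.abs.stronglyMeasurable.integral_prod_left'
    have hi := (integrable_oddKernel_smul (p := 1) (C := C) hη.1 hη.2 hm.aestronglyMeasurable
      fun τ => by
        rw [Real.norm_of_nonneg (hN0 τ), Real.rpow_one]
        exact hC τ).norm
    refine hi.congr (ae_of_all _ fun τ => ?_)
    simp only [norm_smul, Real.norm_of_nonneg (hN0 τ)]
    rw [← integral_const_mul]
    rfl
  · exact ((measurable_oddKernel η).comp measurable_snd).aestronglyMeasurable.smul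
      hcont.aestronglyMeasurable

theorem marchaudIntegrand_frozenFamily (η x τ : ℝ) :
    marchaudIntegrand η (fun s => ∫ u in Iic x, frozenFamily t ε₀ ρ s u) t τ =
      oddKernel η τ • frozenIncrement (distribFun ρ) (-leftEnd t) ε₀ x τ := by
  have h0 : clampParam t ε₀ t - t = 0 := by
    have := clampParam_sub (t := t) (ε := ε₀) 0
    rw [add_zero, min_eq_left hε₀.le, max_eq_right (by linarith)] at this
    exact this
  simp only [marchaudIntegrand]
  rw [h.integral_Iic_frozenFamily ht hε₀.le hε₂, h.integral_Iic_frozenFamily ht hε₀.le hε₂,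
    clampParam_sub, h0, sub_zero]
  rfl

/-- Fubini gives integrability in `τ` for almost every `x` in each `[-n, n]`; countably many null
sets are discarded. -/
theorem ae_integrable_marchaudIntegrand {η : ℝ} (hη : η ∈ Ioo (0 : ℝ) 1) :
    ∀ᵐ x, Integrable
      (marchaudIntegrand η (fun s => ∫ u in Iic x, frozenFamily t ε₀ ρ s u) t) := by
  have hn : ∀ n : ℕ, ∀ᵐ x, x ∈ Icc (-(n : ℝ)) n → Integrable fun τ =>
      oddKernel η τ • frozenIncrement (distribFun ρ) (-leftEnd t) ε₀ x τ := fun n =>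
    (ae_restrict_iff' measurableSet_Icc).1
      (h.integrable_oddKernel_smul_frozenIncrement ht hε₀ hε₂ hη n.cast_nonneg).prod_right_ae
  filter_upwards [ae_all_iff.2 hn] with x hx
  obtain ⟨n, hxn⟩ := exists_nat_ge |x|
  refine (hx n (abs_le.1 hxn)).congr (ae_of_all _ fun τ => ?_)
  exact (h.marchaudIntegrand_frozenFamily ht hε₀ hε₂ η x τ).symm

theorem paramMarchaudPrimitive_ae_eq {η : ℝ} (hη : η ∈ Ioo (0 : ℝ) 1) :
    ∀ᵐ x, paramMarchaudPrimitive η (frozenFamily t ε₀ ρ) t x = marchaudConst η •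
      ∫ τ, oddKernel η τ • frozenIncrement (distribFun ρ) (-leftEnd t) ε₀ x τ := by
  filter_upwards [h.ae_integrable_marchaudIntegrand ht hε₀ hε₂ hη] with x hx
  rw [paramMarchaudPrimitive, marchaud_eq_of_integrable hx]
  congr 1
  exact integral_congr_ae (ae_of_all _ fun τ =>
    h.marchaudIntegrand_frozenFamily ht hε₀ hε₂ η x τ)

theorem paramMarchaudDistribExists {η : ℝ} (hη : η ∈ Ioo (0 : ℝ) 1) :
    ParamMarchaudDistribExists η (frozenFamily t ε₀ ρ) t where
  integrableOn_Iic s x := h.integrableOn_frozenFamily ε₀ s x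
  exists_ae := by
    filter_upwards [h.ae_integrable_marchaudIntegrand ht hε₀ hε₂ hη] with x hx
    exact marchaudExistsAt_of_integrable hx
  locallyIntegrable := by
    rw [locallyIntegrable_iff]
    intro K hK
    obtain ⟨n, hn⟩ := hK.isBounded.exists_norm_le
    have hn' : K ⊆ Icc (-|n|) |n| := fun x hx => abs_le.1 ((hn x hx).trans (le_abs_self n))
    refine IntegrableOn.mono_set ?_ hn'
    have hi := (h.integrable_oddKernel_smul_frozenIncrement ht hε₀ hε₂ hη
      (abs_nonneg n)).integral_prod_left.smul (marchaudConst η)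
    exact hi.congr (ae_restrict_of_ae ((h.paramMarchaudPrimitive_ae_eq ht hε₀ hε₂ hη).mono
      fun x hx => hx.symm))

/-- The Marchaud derivative in the parameter, paired with `ψ`, is the regularised integral of the
increments `-∫ (G_{t+τ} - G_t) ψ'`. -/
theorem paramMarchaudPairing_eq {η : ℝ} (hη : η ∈ Ioo (0 : ℝ) 1) {ψ : ℝ → ℂ}
    (hψ : ContDiff ℝ 1 ψ) (hc : HasCompactSupport ψ) :
    paramMarchaudPairing η (frozenFamily t ε₀ ρ) t ψ = marchaudConst η • ∫ τ, oddKernel η τ •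
      -∫ x, frozenIncrement (distribFun ρ) (-leftEnd t) ε₀ x τ • deriv ψ x := by
  obtain ⟨n, hn⟩ := hc.deriv.isCompact.isBounded.exists_norm_le
  have hoff : ∀ x, x ∉ Icc (-|n|) |n| → deriv ψ x = 0 := by
    intro x hx
    by_contra h0
    exact hx (abs_le.1 ((hn x (subset_tsupport _ h0)).trans (le_abs_self n)))
  obtain ⟨C, -, hC, -⟩ := exists_bound_increment hψ hc
  have hcont' := hψ.continuous_deriv le_rfl
  have hrestrict : ∀ f : ℝ → ℝ, ∫ x, f x • deriv ψ x =
      ∫ x in Icc (-|n|) |n|, f x • deriv ψ x := fun f =>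
    (setIntegral_eq_integral_of_forall_compl_eq_zero fun x hx => by
      rw [hoff x hx, smul_zero]).symm
  -- Restricting to a compact interval containing the support of `ψ'` makes the double integral
  -- absolutely convergent, so the `x` and `τ` integrals may be exchanged.
  have hint : Integrable (fun p : ℝ × ℝ =>
      (oddKernel η p.2 • frozenIncrement (distribFun ρ) (-leftEnd t) ε₀ p.1 p.2) • deriv ψ p.1)
      ((volume.restrict (Icc (-|n|) |n|)).prod volume) :=
    (h.integrable_oddKernel_smul_frozenIncrement ht hε₀ hε₂ hη (abs_nonneg n)).smul_bdd C
      (Continuous.aestronglyMeasurable (by fun_prop)) (ae_of_all _ fun p => hC _)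
  have hL : ∫ x, paramMarchaudPrimitive η (frozenFamily t ε₀ ρ) t x • deriv ψ x =
      marchaudConst η • ∫ x in Icc (-|n|) |n|, ∫ τ, (oddKernel η τ •
        frozenIncrement (distribFun ρ) (-leftEnd t) ε₀ x τ) • deriv ψ x := by
    rw [← integral_smul, hrestrict]
    refine integral_congr_ae (ae_restrict_of_ae ?_)
    filter_upwards [h.paramMarchaudPrimitive_ae_eq ht hε₀ hε₂ hη] with x hx
    rw [hx, integral_smul_const, smul_assoc]
  rw [paramMarchaudPairing, hL, integral_integral_swap hint, ← smul_neg, ← integral_neg]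
  congr 2
  funext τ
  rw [hrestrict, smul_neg, ← integral_smul]
  simp only [smul_assoc]

theorem hasDerivAt_integral_frozenIncrement {ψ : ℝ → ℂ} (hψ : ContDiff ℝ 1 ψ)
    (hc : HasCompactSupport ψ) :
    HasDerivAt (fun τ =>
      -∫ x, frozenIncrement (distribFun ρ) (-leftEnd t) ε₀ x τ • deriv ψ x)
      (∫ x, ρ x • deriv ψ x) 0 := by
  have ht2 : t < 2 := by linarith
  have hcont' := hψ.continuous_deriv le_rfl
  have hRc := continuous_distribFun h.integrable
  refine ((hasDerivAt_integral_smul_translate h.integrable hψ hc).sub_const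
    (∫ v, ρ v • ψ v)).congr_of_eventuallyEq ?_
  have hδ : 0 < -leftEnd t - t := by
    linarith [leftEnd_lt_neg (s := t) (t := t) (by nlinarith)]
  -- For `|τ| < ε₀` the clamp is inactive, and for `τ < -a_t - t` the spatial cut-off is invisible
  -- because `R = 1` on both sides of it.
  filter_upwards [Ioo_mem_nhds (neg_lt_zero.2 hε₀) hε₀, Iio_mem_nhds hδ] with τ hτ hτδ
  have hτδ' : τ < -leftEnd t - t := hτδ
  have hinc : ∀ x, frozenIncrement (distribFun ρ) (-leftEnd t) ε₀ x τ =
      distribFun ρ (x - τ) - distribFun ρ (x - 0) := by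
    intro x
    rw [frozenIncrement, min_eq_left hτ.2.le, max_eq_right hτ.1.le, sub_zero]
    rcases le_total x (-leftEnd t) with hx | hx
    · rw [min_eq_left hx]
    · rw [min_eq_right hx]
      simp only [h.distribFun_eq_one ht ht2 (show t ≤ -leftEnd t - τ by linarith),
        h.distribFun_eq_one ht ht2 (show t ≤ -leftEnd t by linarith),
        h.distribFun_eq_one ht ht2 (show t ≤ x - τ by linarith),
        h.distribFun_eq_one ht ht2 (show t ≤ x by linarith)]
  have hi : ∀ σ, Integrable fun x => distribFun ρ (x - σ) • deriv ψ x := fun σ =>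
    ((hRc.comp (continuous_sub_right σ)).smul hcont').integrable_of_hasCompactSupport
      (HasCompactSupport.smul_left (f := fun x => distribFun ρ (x - σ)) hc.deriv)
  simp only [hinc, sub_smul]
  rw [integral_sub (hi τ) (hi 0), integral_distribFun_smul_deriv h.integrable hψ hc,
    integral_distribFun_smul_deriv h.integrable hψ hc]
  simp only [add_zero]
  ring

/-- The frozen Marchaud derivative tends to the derivative of the translated measure. -/
theorem tendsto_paramMarchaudPairing {ψ : ℝ → ℂ} (hψ : ContDiff ℝ 1 ψ)
    (hc : HasCompactSupport ψ) :
    Tendsto (fun η => paramMarchaudPairing η (frozenFamily t ε₀ ρ) t ψ) (𝓝[<] 1)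
      (𝓝 (∫ x, ρ x • deriv ψ x)) := by
  obtain ⟨n, hn⟩ := hc.deriv.isCompact.isBounded.exists_norm_le
  obtain ⟨C, -, hC, -⟩ := exists_bound_increment hψ hc
  obtain ⟨N, hN⟩ := h.exists_integral_abs_frozenIncrement_le ht hε₀ hε₂ (abs_nonneg n)
  have hcont' := hψ.continuous_deriv le_rfl
  have hcont := h.continuous_frozenIncrement (-leftEnd t) ε₀
  have hC0 : 0 ≤ C := (norm_nonneg _).trans (hC 0)
  have hm : StronglyMeasurable fun τ =>
      -∫ x, frozenIncrement (distribFun ρ) (-leftEnd t) ε₀ x τ • deriv ψ x := by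
    have hc2 : Continuous fun p : ℝ × ℝ =>
        frozenIncrement (distribFun ρ) (-leftEnd t) ε₀ p.1 p.2 • deriv ψ p.1 :=
      hcont.smul (hcont'.comp continuous_fst)
    exact hc2.stronglyMeasurable.integral_prod_left'.neg
  have hbound : ∀ τ, ‖-∫ x, frozenIncrement (distribFun ρ) (-leftEnd t) ε₀ x τ • deriv ψ x‖ ≤
      C * N * min |τ| 1 := by
    intro τ
    have hcont1 : Continuous fun x => frozenIncrement (distribFun ρ) (-leftEnd t) ε₀ x τ :=
      hcont.comp (by fun_prop : Continuous fun x : ℝ => (x, τ))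
    rw [norm_neg, ← setIntegral_eq_integral_of_forall_compl_eq_zero (s := Icc (-|n|) |n|)]
    · calc _ ≤ ∫ x in Icc (-|n|) |n|,
            C * |frozenIncrement (distribFun ρ) (-leftEnd t) ε₀ x τ| := by
            refine norm_integral_le_of_norm_le (hcont1.abs.integrableOn_Icc.const_mul C)
              (ae_of_all _ fun x => ?_)
            rw [norm_smul, mul_comm, Real.norm_eq_abs]
            exact mul_le_mul_of_nonneg_right (hC x) (abs_nonneg _)
        _ ≤ _ := by
            rw [integral_const_mul, mul_assoc]
            exact mul_le_mul_of_nonneg_left (hN τ) hC0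
    · intro x hx
      have : deriv ψ x = 0 := by
        by_contra h0
        exact hx (abs_le.1 ((hn x (subset_tsupport _ h0)).trans (le_abs_self n)))
      rw [this, smul_zero]
  refine (tendsto_marchaudConst_integral hm.aestronglyMeasurable hbound
    (h.hasDerivAt_integral_frozenIncrement ht hε₀ hε₂ hψ hc)).congr' ?_
  filter_upwards [(Ioo_mem_nhdsLT one_pos : Ioo (0 : ℝ) 1 ∈ 𝓝[<] 1)] with η hη
  exact (h.paramMarchaudPairing_eq ht hε₀ hε₂ hη hψ hc).symm

end IsInvariantDensity

/-- Both fractional susceptibility functions (and Ruelle's) are well defined as formal power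
series, and the fractional ones tend to Ruelle's as `η ↑ 1`. -/
theorem propositionD (t₀ ε₀ : ℝ) (ht₀ : t₀ ∈ Ioo (1 : ℝ) 2)
    (hε₀ : 0 < ε₀) (hε₁ : 1 < t₀ - ε₀) (hε₂ : t₀ + ε₀ < 2)
    (ρ : ℝ → ℝ) (hρ : IsInvariantDensity t₀ ρ)
    (φ : ℝ → ℂ) (hφ : ContDiff ℝ 1 φ) (hφc : HasCompactSupport φ) :
    (∀ k : ℕ, Integrable fun x => ρ x • deriv (φ ∘ (quadMap t₀)^[k]) x) ∧
    (∀ η ∈ Ioo (0 : ℝ) 1,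
      ParamMarchaudDistribExists η (frozenFamily t₀ ε₀ ρ) t₀ ∧
      ∀ k : ℕ,
        (ContDiff ℝ 1 (φ ∘ (quadMap t₀)^[k]) ∧ HasCompactSupport (φ ∘ (quadMap t₀)^[k])) ∧
        (∀ x : ℝ, MarchaudExistsAt η (φ ∘ (quadMap t₀)^[k]) x) ∧
        IntegrableOn (fun x => ρ x • marchaud η (φ ∘ (quadMap t₀)^[k]) x) (phaseInterval t₀)) ∧
    FormalTendsto (fun η => frozenSusceptibility t₀ ε₀ ρ φ η) (𝓝[<] 1)
      (ruelleSusceptibility t₀ ρ φ) ∧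
    FormalTendsto (fun η => responseSusceptibility t₀ ρ φ η) (𝓝[<] 1)
      (ruelleSusceptibility t₀ ρ φ) := by
  have hψ := contDiff_comp_iterate_quadMap hφ t₀
  have hψc := hasCompactSupport_comp_iterate_quadMap hφc t₀
  refine ⟨fun k => integrable_smul_deriv (hψ k) (hψc k) hρ.integrable, fun η hη =>
    ⟨hρ.paramMarchaudDistribExists ht₀.1 hε₀ hε₂ hη, fun k => ⟨⟨hψ k, hψc k⟩, fun x =>
      marchaudExistsAt_of_integrable (integrable_marchaudIntegrand (hψ k) (hψc k) hη x),
      (integrable_smul_marchaud (hψ k) (hψc k) hρ.integrable hη).integrableOn⟩⟩,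
    fun k => ?_, fun k => ?_⟩
  · simp only [frozenSusceptibility, ruelleSusceptibility, PowerSeries.coeff_mk]
    exact hρ.tendsto_paramMarchaudPairing ht₀.1 hε₀ hε₂ (hψ k) (hψc k)
  · simp only [responseSusceptibility, ruelleSusceptibility, PowerSeries.coeff_mk]
    refine (tendsto_integral_smul_marchaud (hψ k) (hψc k) hρ.integrable).congr fun η => ?_
    refine (setIntegral_eq_integral_of_ae_compl_eq_zero ?_).symm
    filter_upwards [hρ.eq_zero_off] with x hx hxI
    rw [hx hxI, zero_smul]
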